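/- Let $K$ be a number field, let $S$ be a finite set of (non-archimedean) primes of $K$, and fix an algebraic closure $\overline{K}$ of $K$. Then there are only finitely many Galois extensions $L/K$ with $L\subseteq\overline{K}$ that are unramified at every non-archimedean prime of $K$ not in $S$ and whose Galois group $\operatorname{Gal}(L/K)$ is isomorphic to the cyclic group $C_2$, the cyclic group $C_3$ or the symmetric group $S_3$. (Equivalently, there are only finitely many such extensions $L/K$ up to $K$-isomorphism.) -/

import Mathlib

open NumberField

/-! The Galois groups allowed have order 2, 3 or 6, so it suffices to treat a fixed degree `n`.
Hermite's theorem gives finiteness once the discriminant is bounded. Since the discriminant of `L`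
is `N(𝔇) * |d_K| ^ n` in absolute value, the task is to bound the different `𝔇`. Only primes over
`S` divide it, and its exponents there are controlled by the trace of 1, which is `n`
(`dvd_span_finrank_of_map_dvd_differentIdeal`), and by Galois invariance (`smul_differentIdeal`). -/

theorem Ideal.dvd_of_forall_prime_pow_dvd {R : Type*} [CommRing R] [IsDedekindDomain R]
    {I J : Ideal R} (hI : I ≠ ⊥)
    (h : ∀ P : Ideal R, P.IsPrime → P ≠ ⊥ → ∀ k, P ^ k ∣ I → P ^ k ∣ J) : I ∣ J := by
  rw [UniqueFactorizationMonoid.dvd_iff_emultiplicity_le hI]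
  intro P hP
  rw [emultiplicity_le_emultiplicity_iff]
  exact h P (Ideal.isPrime_of_prime hP) hP.ne_zero

namespace NumberField

open Pointwise in
theorem smul_map_algebraMap {K L : Type*} [Field K] [Field L] [Algebra K L] (σ : Gal(L/K))
    (I : Ideal (𝓞 K)) :
    σ • I.map (algebraMap (𝓞 K) (𝓞 L)) = I.map (algebraMap (𝓞 K) (𝓞 L)) := by
  rw [Ideal.pointwise_smul_def, Ideal.map_map]
  congr 1
  ext x
  exact σ.commutes (x : K)

variable {K L : Type*} [Field K] [NumberField K] [Field L] [NumberField L] [Algebra K L]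

/-- This form uses only traces and integrality, both preserved by automorphisms over `K`, so Galois
invariance of the different can be read off. -/
theorem mem_differentIdeal_iff {x : 𝓞 L} :
    x ∈ differentIdeal (𝓞 K) (𝓞 L) ↔
      ∀ y : L, (∀ b : 𝓞 L, IsIntegral ℤ (Algebra.trace K L (y * b))) → IsIntegral ℤ (x * y) := by
  have h : x ∈ differentIdeal (𝓞 K) (𝓞 L) ↔
      algebraMap (𝓞 L) L x ∈ IsLocalization.coeSubmodule L (differentIdeal (𝓞 K) (𝓞 L)) := by
    rw [← FractionalIdeal.coe_coeIdeal (S := nonZeroDivisors (𝓞 L))]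
    simp
  have hint {z : L} : IsIntegral ℤ z ↔ ∃ c : 𝓞 L, algebraMap (𝓞 L) L c = z :=
    IsIntegralClosure.isIntegral_iff
  have hint' {z : K} : IsIntegral ℤ z ↔ ∃ c : 𝓞 K, algebraMap (𝓞 K) K c = z :=
    IsIntegralClosure.isIntegral_iff
  rw [h, coeSubmodule_differentIdeal (𝓞 K) K, Submodule.mem_div_iff_forall_mul_mem]
  simp only [Submodule.mem_traceDual, Algebra.traceForm_apply, Submodule.mem_one,
    forall_exists_index, forall_apply_eq_imp_iff, RingHom.mem_range, hint, hint']

open Pointwise in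
theorem smul_differentIdeal (σ : Gal(L/K)) :
    σ • differentIdeal (𝓞 K) (𝓞 L) = differentIdeal (𝓞 K) (𝓞 L) := by
  have key (τ : Gal(L/K)) (x : 𝓞 L) (hx : x ∈ differentIdeal (𝓞 K) (𝓞 L)) :
      τ • x ∈ differentIdeal (𝓞 K) (𝓞 L) := by
    rw [mem_differentIdeal_iff] at hx ⊢
    intro y hy
    have h1 := hx (τ⁻¹ y) fun b ↦ by
      have h2 := hy (τ • b)
      rwa [← Algebra.trace_eq_of_algEquiv τ, map_mul, ← AlgEquiv.mul_apply, mul_inv_cancel,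
        AlgEquiv.one_apply]
    have h3 := h1.map (τ.toAlgHom.restrictScalars ℤ)
    have h4 : ((τ • x : 𝓞 L) : L) * y = τ ((x : L) * τ⁻¹ y) := by
      rw [map_mul, ← AlgEquiv.mul_apply, mul_inv_cancel, AlgEquiv.one_apply]
      rfl
    rw [h4]
    exact h3
  ext x
  rw [Ideal.mem_pointwise_smul_iff_inv_smul_mem]
  exact ⟨fun h ↦ by simpa using key σ _ h, key σ⁻¹ x⟩

/-- The trace sends the inverse of `J 𝓞_L` into `𝓞_K`. On `x ∈ J⁻¹` it is multiplication by `n = [L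
: K]`, so `n J⁻¹ ⊆ 𝓞_K`, that is, `n ∈ J`. -/
theorem dvd_span_finrank_of_map_dvd_differentIdeal {J : Ideal (𝓞 K)} (hJ : J ≠ ⊥)
    (h : J.map (algebraMap (𝓞 K) (𝓞 L)) ∣ differentIdeal (𝓞 K) (𝓞 L)) :
    J ∣ Ideal.span {(Module.finrank K L : 𝓞 K)} := by
  have hJ' : J.map (algebraMap (𝓞 K) (𝓞 L)) ≠ ⊥ := by
    rwa [Ne, Ideal.map_eq_bot_iff_of_injective (FaithfulSMul.algebraMap_injective _ _)]
  have key := (differentialIdeal_le_iff (K := K) (L := L) hJ').mp (Ideal.le_of_dvd h)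
  have hJ0 : (J : FractionalIdeal (nonZeroDivisors (𝓞 K)) K) ≠ 0 := by simpa
  have hJ0' : ((J.map (algebraMap (𝓞 K) (𝓞 L)) : Ideal (𝓞 L)) :
      FractionalIdeal (nonZeroDivisors (𝓞 L)) L) ≠ 0 := by simpa
  have hn : ((Module.finrank K L : K)) ∈
      ((J : FractionalIdeal (nonZeroDivisors (𝓞 K)) K)⁻¹)⁻¹ := by
    rw [FractionalIdeal.mem_inv_iff (inv_ne_zero hJ0)]
    intro x hx
    have hx' : algebraMap K L x ∈ ((J.map (algebraMap (𝓞 K) (𝓞 L)) : Ideal (𝓞 L)) :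
        FractionalIdeal (nonZeroDivisors (𝓞 L)) L)⁻¹ := by
      rw [FractionalIdeal.mem_inv_iff hJ0']
      rw [FractionalIdeal.mem_inv_iff hJ0] at hx
      intro y hy
      obtain ⟨y, hyJ, rfl⟩ := (FractionalIdeal.mem_coeIdeal _).mp hy
      clear hy
      induction hyJ using Submodule.span_induction with
      | mem y h =>
        obtain ⟨z, hz, rfl⟩ := h
        obtain ⟨w, hw⟩ := (FractionalIdeal.mem_one_iff _).mp
          (hx _ (FractionalIdeal.mem_coeIdeal_of_mem _ hz))
        refine (FractionalIdeal.mem_one_iff _).mpr ⟨algebraMap (𝓞 K) (𝓞 L) w, ?_⟩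
        rw [← IsScalarTower.algebraMap_apply, ← IsScalarTower.algebraMap_apply,
          IsScalarTower.algebraMap_apply _ K L, hw, map_mul, ← IsScalarTower.algebraMap_apply]
      | zero => simp
      | add y z _ _ hy hz =>
        rw [map_add, mul_add]
        exact Submodule.add_mem _ hy hz
      | smul a y _ hy =>
        rw [smul_eq_mul, map_mul, mul_left_comm, ← Algebra.smul_def]
        exact Submodule.smul_mem _ a hy
    obtain ⟨c, hc⟩ := Submodule.mem_one.mp (key ⟨_, hx', rfl⟩)
    refine (FractionalIdeal.mem_one_iff _).mpr ⟨c, ?_⟩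
    rw [hc]
    simp [Algebra.trace_algebraMap]
  rw [inv_inv] at hn
  obtain ⟨m, hm, hm'⟩ := (FractionalIdeal.mem_coeIdeal _).mp hn
  have hmn : m = (Module.finrank K L : 𝓞 K) :=
    FaithfulSMul.algebraMap_injective (𝓞 K) K (by rw [hm', map_natCast])
  rwa [Ideal.dvd_span_singleton, ← hmn]

open scoped Classical Pointwise in
/-- The different ideal of a Galois extension of degree `n` that is unramified outside `S` divides
the product of `n` and the primes in `S`. -/
theorem differentIdeal_dvd_of_unramified_outside [IsGalois K L]
    (S : Finset (IsDedekindDomain.HeightOneSpectrum (𝓞 K)))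
    (hS : ∀ 𝔭 ∉ S, Algebra.IsUnramifiedIn (𝓞 L) 𝔭.asIdeal) :
    differentIdeal (𝓞 K) (𝓞 L) ∣
      (Ideal.span {(Module.finrank K L : 𝓞 K)} * ∏ 𝔭 ∈ S, 𝔭.asIdeal).map
        (algebraMap (𝓞 K) (𝓞 L)) := by
  refine Ideal.dvd_of_forall_prime_pow_dvd differentIdeal_ne_bot fun P hP hP0 k hk ↦ ?_
  rcases Nat.eq_zero_or_pos k with rfl | hk0
  · simp
  let p : IsDedekindDomain.HeightOneSpectrum (𝓞 K) :=
    ⟨P.under (𝓞 K), inferInstance, mt Ideal.eq_bot_of_comap_eq_bot hP0⟩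
  have hpS : p ∈ S := by
    by_contra hp
    exact not_dvd_differentIdeal_iff.mpr (hS p hp P hP ⟨rfl⟩) ((dvd_pow_self P hk0.ne').trans hk)
  have hPp : P ∣ p.asIdeal.map (algebraMap (𝓞 K) (𝓞 L)) :=
    Ideal.dvd_iff_le.mpr Ideal.map_comap_le
  have hex : ∃ j, P ^ k ∣ (p.asIdeal ^ j).map (algebraMap (𝓞 K) (𝓞 L)) :=
    ⟨k, by rw [Ideal.map_pow]; exact pow_dvd_pow_of_dvd hPp k⟩
  -- With `j` the last exponent for which `P ^ k` fails to divide, `p ^ j` will divide `n`; the one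
  -- missing factor `p` is supplied by the product over `S`.
  obtain ⟨j, hj, hmin⟩ : ∃ j, P ^ k ∣ (p.asIdeal ^ (j + 1)).map (algebraMap (𝓞 K) (𝓞 L)) ∧
      ¬ P ^ k ∣ (p.asIdeal ^ j).map (algebraMap (𝓞 K) (𝓞 L)) := by
    obtain ⟨j, hj⟩ : ∃ j, Nat.find hex = j + 1 := by
      refine Nat.exists_eq_succ_of_ne_zero fun h0 ↦ ?_
      have := Nat.find_spec hex
      rw [h0, pow_zero, Ideal.one_eq_top, Ideal.map_top, ← Ideal.one_eq_top] at this
      have := (dvd_pow_self P hk0.ne').trans this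
      exact hP.ne_top (Ideal.isUnit_iff.mp (isUnit_of_dvd_one this))
    exact ⟨j, hj ▸ Nat.find_spec hex, Nat.find_min hex (by omega)⟩
  have hpj : p.asIdeal ^ j ≠ ⊥ := pow_ne_zero _ p.ne_bot
  have hdvd : p.asIdeal ^ j ∣ Ideal.span {(Module.finrank K L : 𝓞 K)} := by
    refine dvd_span_finrank_of_map_dvd_differentIdeal hpj ?_
    refine Ideal.dvd_of_forall_prime_pow_dvd
      (by rwa [Ne, Ideal.map_eq_bot_iff_of_injective (FaithfulSMul.algebraMap_injective _ _)])
      fun Q hQ hQ0 m hm ↦ ?_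
    rcases Nat.eq_zero_or_pos m with rfl | hm0
    · simp
    have hQp : p.asIdeal.map (algebraMap (𝓞 K) (𝓞 L)) ≤ Q := by
      have h := Ideal.le_of_dvd ((dvd_pow_self Q hm0.ne').trans hm)
      rw [Ideal.map_pow] at h
      exact hQ.le_of_pow_le h
    have : Q.LiesOver p.asIdeal :=
      ⟨p.isMaximal.eq_of_le (hQ.under (𝓞 K)).ne_top (Ideal.map_le_iff_le_comap.mp hQp)⟩
    have : P.LiesOver p.asIdeal := ⟨rfl⟩
    -- Transitivity on the primes over `p` moves the comparison from `Q` to `P`, where `m ≤ k` by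
    -- the choice of `j`.
    obtain ⟨σ, rfl⟩ := Ideal.exists_smul_eq_of_isGaloisGroup p.asIdeal P Q Gal(L/K)
    have hm' : P ^ m ∣ (p.asIdeal ^ j).map (algebraMap (𝓞 K) (𝓞 L)) := by
      rwa [← smul_pow', ← smul_map_algebraMap σ, Ideal.dvd_iff_le,
        Ideal.pointwise_smul_le_pointwise_smul_iff, ← Ideal.dvd_iff_le] at hm
    have hmk : m ≤ k := by
      by_contra! hkm
      exact hmin ((pow_dvd_pow P hkm.le).trans hm')
    rw [← smul_pow', ← smul_differentIdeal σ, Ideal.dvd_iff_le,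
      Ideal.pointwise_smul_le_pointwise_smul_iff, ← Ideal.dvd_iff_le]
    exact (pow_dvd_pow P hmk).trans hk
  refine hj.trans ?_
  rw [Ideal.dvd_iff_le]
  refine Ideal.map_mono (Ideal.le_of_dvd ?_)
  rw [pow_succ]
  exact mul_dvd_mul hdvd (Finset.dvd_prod_of_mem _ hpS)

theorem natAbs_discr_le_of_unramified_outside [IsGalois K L]
    (S : Finset (IsDedekindDomain.HeightOneSpectrum (𝓞 K)))
    (hS : ∀ 𝔭 ∉ S, Algebra.IsUnramifiedIn (𝓞 L) 𝔭.asIdeal) :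
    (discr L).natAbs ≤ (Ideal.absNorm (Ideal.span {(Module.finrank K L : 𝓞 K)} *
      ∏ 𝔭 ∈ S, 𝔭.asIdeal) * (discr K).natAbs) ^ Module.finrank K L := by
  rw [natAbs_discr_eq_absNorm_differentIdeal_mul_natAbs_discr_pow K (𝓞 K) L (𝓞 L), mul_pow]
  refine Nat.mul_le_mul_right _ (Nat.le_of_dvd (pow_pos (Nat.pos_of_ne_zero ?_) _) ?_)
  · rw [Ne, Ideal.absNorm_eq_zero_iff, ← Ideal.zero_eq_bot, mul_eq_zero, Finset.prod_eq_zero_iff]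
    rintro (h | ⟨𝔭, -, h⟩)
    · simp [Module.finrank_pos.ne'] at h
    · exact 𝔭.ne_bot h
  · have := map_dvd Ideal.absNorm (differentIdeal_dvd_of_unramified_outside S hS)
    rwa [Ideal.absNorm_algebraMap, ← IsFractionRing.finrank_eq (𝓞 K) K (𝓞 L) L] at this

end NumberField

/-- **Hermite–Minkowski**: in a fixed extension of a number field `K`, there are only finitely many
Galois extensions of `K` of given degree that are unramified outside a given finite set of primes. -/
theorem NumberField.finite_setOf_isGalois_unramified_outside (K : Type*) [Field K] [NumberField K]
    (Ω : Type*) [Field Ω] [Algebra K Ω]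
    {S : Set (IsDedekindDomain.HeightOneSpectrum (𝓞 K))} (hS : S.Finite) {n : ℕ} (hn : n ≠ 0) :
    {L : IntermediateField K Ω | IsGalois K L ∧
      (∀ 𝔭 : IsDedekindDomain.HeightOneSpectrum (𝓞 K), 𝔭 ∉ S →
        Algebra.IsUnramifiedIn (𝓞 L) 𝔭.asIdeal) ∧ Module.finrank K L = n}.Finite := by
  have : CharZero Ω := charZero_of_injective_algebraMap (algebraMap K Ω).injective
  let N := (Ideal.absNorm (Ideal.span {(n : 𝓞 K)} *
      ∏ 𝔭 ∈ hS.toFinset, 𝔭.asIdeal) * (discr K).natAbs) ^ n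
  -- Hermite's theorem concerns subfields over `ℚ`; forgetting `K` is injective, so finiteness
  -- descends.
  refine Set.Finite.of_finite_image (f := IntermediateField.restrictScalars ℚ) (Set.Finite.subset
    ((NumberField.finite_of_discr_bdd Ω N).image Subtype.val) ?_)
    (IntermediateField.restrictScalars_injective ℚ).injOn
  rintro _ ⟨L, ⟨hGal, hunr, hdeg⟩, rfl⟩
  have hfin : FiniteDimensional K L := .of_finrank_pos (by omega)
  have : FiniteDimensional ℚ L := .trans ℚ K L
  have : CharZero L := charZero_of_injective_algebraMap (algebraMap K L).injective
  have : NumberField L := ⟨⟩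
  refine ⟨⟨L.restrictScalars ℚ, ‹NumberField L›.to_finiteDimensional⟩, ?_, rfl⟩
  have h := natAbs_discr_le_of_unramified_outside (K := K) (L := L) hS.toFinset
    (by simpa using hunr)
  rw [hdeg] at h
  change |discr L| ≤ N
  rw [Int.abs_eq_natAbs]
  exact_mod_cast h

/-- Let `K` be a number field, `S` a finite set of finite primes of `K`, and `Ω` an algebraic
closure of `K`. There are only finitely many subextensions `L / K` of `Ω / K` that are Galois,
unramified at every prime of `K` outside `S`, and have Galois group isomorphic to
`C₂`, `C₃` or `S₃`. -/
theorem mainTheorem1 (K : Type*) [Field K] [NumberField K]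
    (Ω : Type*) [Field Ω] [Algebra K Ω] [IsAlgClosure K Ω]
    (S : Set (IsDedekindDomain.HeightOneSpectrum (𝓞 K))) (hS : S.Finite) :
    {L : IntermediateField K Ω |
      IsGalois K L ∧
      (∀ 𝔭 : IsDedekindDomain.HeightOneSpectrum (𝓞 K), 𝔭 ∉ S →
        Algebra.IsUnramifiedIn (𝓞 L) 𝔭.asIdeal) ∧
      (Nonempty (Gal(L/K) ≃* Multiplicative (ZMod 2)) ∨
        Nonempty (Gal(L/K) ≃* Multiplicative (ZMod 3)) ∨
        Nonempty (Gal(L/K) ≃* Equiv.Perm (Fin 3)))}.Finite := by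
  have hfin (n : ℕ) (hn : n ≠ 0) := finite_setOf_isGalois_unramified_outside K Ω hS hn
  refine ((hfin 2 (by norm_num)).union ((hfin 3 (by norm_num)).union
    (hfin 6 (by norm_num)))).subset ?_
  rintro L ⟨hGal, hunr, hiso⟩
  have hcard : Module.finrank K L = Nat.card Gal(L/K) :=
    (IsGaloisGroup.card_eq_finrank Gal(L/K) K L).symm
  rcases hiso with ⟨⟨e⟩⟩ | ⟨⟨e⟩⟩ | ⟨⟨e⟩⟩
  · refine .inl ⟨hGal, hunr, ?_⟩
    rw [hcard, Nat.card_congr e.toEquiv]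
    simp
  · refine .inr (.inl ⟨hGal, hunr, ?_⟩)
    rw [hcard, Nat.card_congr e.toEquiv]
    simp
  · refine .inr (.inr ⟨hGal, hunr, ?_⟩)
    rw [hcard, Nat.card_congr e.toEquiv, Nat.card_perm]
    simp [Nat.factorial]
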